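/- Let $n\ge 2$ and $k\ge 1$ be integers, $\lambda\ge 0$, $M>0$, $\alpha\in(0,1]$, and let $f:[0,1]\to\mathbb{R}$ satisfy $|f(x)-f(y)|\le M|x-y|^{\alpha}$ for all $x,y\in[0,1]$. Let $x_i=\frac{i-1}{n-1}$ for $i=1,\dots,n$, and let $y_i=(f(x_i)+\eta_i)\bmod 1$ be noisy modulo-$1$ samples of $f$ with arbitrary $\eta_i\in\mathbb{R}$. Put $h_i=\exp(2\pi\iota f(x_i))$, $z_i=\exp(2\pi\iota y_i)$ (with $\iota=\sqrt{-1}$), and $$\bar{\mathbf h}=\begin{pmatrix}\mathrm{Re}(\mathbf h)\\ \mathrm{Im}(\mathbf h)\end{pmatrix},\qquad \bar{\mathbf z}=\begin{pmatrix}\mathrm{Re}(\mathbf z)\\ \mathrm{Im}(\mathbf z)\end{pmatrix}\in\mathbb{R}^{2n}.$$ Let $L\in\mathbb{R}^{n\times n}$ be the Laplacian matrix of the graph on $\{1,\dots,n\}$ in which distinct $i,j$ are adjacent if and only if $|i-j|\le k$, let $H=\begin{pmatrix}\lambda L&0\\0&\lambda L\end{pmatrix}\in\mathbb{R}^{2n\times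 2n}$, and let $\mathcal N(H)$ be the null space of $H$. Assume that $\|\bar{\mathbf z}-\bar{\mathbf h}\|_2\le\delta\sqrt n$ for some $\delta\in[0,1]$. Consider the problem $$\min_{\bar{\mathbf g}\in\mathbb{R}^{2n}:\ \|\bar{\mathbf g}\|_2^2=n}\ \bar{\mathbf g}^{T}H\bar{\mathbf g}-2\bar{\mathbf g}^{T}\bar{\mathbf z}.\qquad (P)$$ (1) If $\bar{\mathbf z}$ is not orthogonal to $\mathcal N(H)$, then $(P)$ has a unique solution $\hat{\mathbf g}$, and it satisfies $$\frac1n\langle\bar{\mathbf h},\hat{\mathbf g}\rangle\ \ge\ 1-\frac{3\delta}{2}-\frac{\lambda\pi^2M^2(2k)^{2\alpha+1}}{n^{2\alpha}}+\frac{1}{(4\lambda k+1)^2}\left(\frac{1}{2n}\bar{\mathbf z}^{T}H\bar{\mathbf z}\right).$$ (2) If $\bar{\mathbf z}\perp\mathcal N(H)$ and $\lambda<\frac{1}{4k}$, then $(P)$ has a unique solution $\hat{\mathbf g}$, and it satisfies $$\frac1n\langle\bar{\mathbf h},\hat{\mathbf g}\rangle\ \ge\ 1-\frac{3\delta}{2}-\frac{\lambda\pi^2M^2(2k)^{2\alpha+1}}{n^{2\alpha}}+\frac{1}{\left(1+4\lambda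 k-4\lambda k\sin^2\left(\frac{\pi}{2n}\right)\right)^2}\left(\frac{1}{2n}\bar{\mathbf z}^{T}H\bar{\mathbf z}\right).$$ -/

import Mathlib

noncomputable section

namespace ModuloDenoise

/-- The uniform grid on `[0,1]`: the points `i / (n - 1)`, `i = 0, …, n - 1`. -/
def grid (n : ℕ) (i : Fin n) : ℝ := (i : ℝ) / ((n : ℝ) - 1)

/-- The clean signal on the unit circle, `h_i = exp (2 π ι f(x_i))`. -/
def cleanSignal (n : ℕ) (f : ℝ → ℝ) (i : Fin n) : ℂ :=
  Complex.exp (2 * Real.pi * Complex.I * (f (grid n i) : ℂ))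

/-- The noisy modulo 1 samples `y_i = (f(x_i) + η_i) mod 1`. -/
def noisySample (n : ℕ) (f : ℝ → ℝ) (η : Fin n → ℝ) (i : Fin n) : ℝ :=
  Int.fract (f (grid n i) + η i)

/-- The noisy signal on the unit circle, `z_i = exp (2 π ι y_i)`. -/
def noisySignal (n : ℕ) (f : ℝ → ℝ) (η : Fin n → ℝ) (i : Fin n) : ℂ :=
  Complex.exp (2 * Real.pi * Complex.I * (noisySample n f η i : ℂ))

/-- The real version `(Re g, Im g)` of a complex vector `g`, with the Euclidean structure
of `ℝ^(2n)`. -/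
def realify {n : ℕ} (g : Fin n → ℂ) : EuclideanSpace ℝ (Fin n ⊕ Fin n) :=
  WithLp.toLp 2 (Sum.elim (fun i => (g i).re) (fun i => (g i).im))

/-- The nearest neighbour graph on `n` vertices: distinct `i`, `j` are adjacent iff
`|i - j| ≤ k`. -/
def nnGraph (n k : ℕ) : SimpleGraph (Fin n) where
  Adj i j := i ≠ j ∧ |((i : ℕ) : ℤ) - ((j : ℕ) : ℤ)| ≤ (k : ℤ)
  symm := ⟨fun i j h => ⟨h.1.symm, by rw [abs_sub_comm]; exact h.2⟩⟩
  loopless := ⟨fun _ h => h.1 rfl⟩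

instance (n k : ℕ) : DecidableRel (nnGraph n k).Adj := fun i j =>
  inferInstanceAs (Decidable (i ≠ j ∧ |((i : ℕ) : ℤ) - ((j : ℕ) : ℤ)| ≤ (k : ℤ)))

/-- The block-diagonal regularization matrix `H = diag (lam L, lam L)`, where `L` is the Laplacian
of the nearest neighbour graph. -/
def regMatrix (n k : ℕ) (lam : ℝ) : Matrix (Fin n ⊕ Fin n) (Fin n ⊕ Fin n) ℝ :=
  Matrix.fromBlocks (lam • (nnGraph n k).lapMatrix ℝ) 0 0 (lam • (nnGraph n k).lapMatrix ℝ)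

/-- The quadratic form `gᵀ H g`. -/
def quadForm {n : ℕ} (H : Matrix (Fin n ⊕ Fin n) (Fin n ⊕ Fin n) ℝ)
    (g : EuclideanSpace ℝ (Fin n ⊕ Fin n)) : ℝ :=
  inner ℝ g (Matrix.toEuclideanLin H g)

/-- The null space of `H`. -/
def nullSpace {n : ℕ} (H : Matrix (Fin n ⊕ Fin n) (Fin n ⊕ Fin n) ℝ) :
    Submodule ℝ (EuclideanSpace ℝ (Fin n ⊕ Fin n)) :=
  LinearMap.ker (Matrix.toEuclideanLin H)

/-- The objective `gᵀ H g - 2 gᵀ z`. -/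
def objective {n : ℕ} (H : Matrix (Fin n ⊕ Fin n) (Fin n ⊕ Fin n) ℝ)
    (z g : EuclideanSpace ℝ (Fin n ⊕ Fin n)) : ℝ :=
  quadForm H g - 2 * inner ℝ g z

/-- `g` is a (global) solution of the trust-region problem: minimize `gᵀ H g - 2 gᵀ z` subject to
`‖g‖² = n`. -/
def IsSolution {n : ℕ} (H : Matrix (Fin n ⊕ Fin n) (Fin n ⊕ Fin n) ℝ)
    (z g : EuclideanSpace ℝ (Fin n ⊕ Fin n)) : Prop :=
  ‖g‖ ^ 2 = (n : ℝ) ∧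
    ∀ g' : EuclideanSpace ℝ (Fin n ⊕ Fin n), ‖g'‖ ^ 2 = (n : ℝ) →
      objective H z g ≤ objective H z g'

end ModuloDenoise

end

/-! A minimizer `g` on the sphere satisfies `H g + μ g = z` for a multiplier `μ`. Reflecting `g` in
hyperplanes gives `μ ≥ 0`, because `H` has a kernel. If `z` is not the image under `H` of a point of
the sphere, then `μ > 0` and the minimizer is unique. This holds in case (1) because the range of
`H` is orthogonal to its kernel, and in case (2) because `H` strictly shrinks norms.

Comparing the objective at `g` and at the clean signal `h` bounds `⟨h, g⟩` below in terms of `δ`,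
`hᵀHh` and `gᵀHg` (`inner_solution_ge`). Hölder continuity controls `hᵀHh`
(`quadForm_cleanSignal_le`). Since `‖z‖ = ‖g‖` forces `μ ≤ 1`, one has `zᵀHz = gᵀ(H + μ)²Hg ≤ (c +
1)² gᵀHg` for any upper bound `c ≥ 0` of the form (`quadratic_le_of_multiplier`). The value `c = 4λk
cos²(π/2n)` comes from cutting the graph, distance by distance, into paths
(`sum_nnGraph_sub_sq_le`). -/

/-! ### Minimizing a quadratic on a sphere in an inner product space. -/

section TrustRegion

variable {E : Type*} [NormedAddCommGroup E] [InnerProductSpace ℝ E]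

/-- This is `T² ≤ cT` for `0 ≤ T ≤ c`, obtained without diagonalizing: positivity of the form at `x
- t • T x`, with `t = 1 / c`. -/
theorem LinearMap.IsSymmetric.norm_sq_apply_le {T : E →ₗ[ℝ] E} (hT : T.IsSymmetric)
    (hpos : ∀ x, 0 ≤ inner ℝ x (T x)) {c : ℝ} (hc : ∀ x, inner ℝ x (T x) ≤ c * ‖x‖ ^ 2)
    (hc0 : 0 ≤ c) (x : E) : ‖T x‖ ^ 2 ≤ c * inner ℝ x (T x) := by
  have key : ∀ t : ℝ, 0 ≤ inner ℝ x (T x) - 2 * t * ‖T x‖ ^ 2 + t ^ 2 * (c * ‖T x‖ ^ 2) := by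
    intro t
    have h1 := hpos (x - t • T x)
    have h2 : inner ℝ x (T (T x)) = ‖T x‖ ^ 2 := by
      rw [← hT x (T x), real_inner_self_eq_norm_sq]
    have h3 : inner ℝ (T x) (T x) = ‖T x‖ ^ 2 := real_inner_self_eq_norm_sq _
    simp only [map_sub, map_smul, inner_sub_left, inner_sub_right, inner_smul_left,
      inner_smul_right, h2, h3, RCLike.conj_to_real] at h1
    have h4 := mul_le_mul_of_nonneg_left (hc (T x)) (sq_nonneg t)
    nlinarith
  rcases hc0.eq_or_lt with h0 | h0
  · subst h0
    have h1 := key 1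
    have h2 := hc x
    nlinarith [sq_nonneg ‖T x‖]
  · have h1 := mul_nonneg h0.le (key (1 / c))
    have h2 : c * (inner ℝ x (T x) - 2 * (1 / c) * ‖T x‖ ^ 2 + (1 / c) ^ 2 * (c * ‖T x‖ ^ 2))
        = c * inner ℝ x (T x) - ‖T x‖ ^ 2 := by
      field_simp
      ring
    linarith

theorem quadratic_add (T : E →ₗ[ℝ] E) (hT : T.IsSymmetric) (z g d : E) :
    inner ℝ (g + d) (T (g + d)) - 2 * inner ℝ (g + d) z
      = inner ℝ g (T g) - 2 * inner ℝ g z + 2 * inner ℝ (T g - z) d + inner ℝ d (T d) := by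
  have h1 : inner ℝ g (T d) = inner ℝ d (T g) := by
    rw [← hT g d, real_inner_comm]
  simp only [map_add, inner_add_left, inner_add_right, inner_sub_left, h1,
    real_inner_comm d (T g), real_inner_comm d z]
  ring

/-- Comparing a minimizer on a sphere with its reflection in the hyperplane orthogonal to `v`. -/
theorem reflection_inequality {T : E →ₗ[ℝ] E} (hT : T.IsSymmetric) {z g : E} {r : ℝ}
    (hg : ‖g‖ ^ 2 = r)
    (hmin : ∀ g' : E, ‖g'‖ ^ 2 = r →
      inner ℝ g (T g) - 2 * inner ℝ g z ≤ inner ℝ g' (T g') - 2 * inner ℝ g' z) (v : E) :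
    inner ℝ g v * inner ℝ (T g - z) v * ‖v‖ ^ 2 ≤ inner ℝ g v ^ 2 * inner ℝ v (T v) := by
  by_cases hv : v = 0
  · simp [hv]
  have hv2 : 0 < ‖v‖ ^ 2 := by positivity
  set s := inner ℝ g v with hs
  set t := -(2 * s / ‖v‖ ^ 2) with ht
  have htv : t * ‖v‖ ^ 2 = -(2 * s) := by rw [ht]; field_simp
  have h1 : ‖g + t • v‖ ^ 2 = r := by
    rw [norm_add_sq_real, hg, inner_smul_right, ← hs, norm_smul, mul_pow, Real.norm_eq_abs, sq_abs]
    linear_combination t * htv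
  have h2 := hmin _ h1
  rw [quadratic_add T hT, map_smul, inner_smul_right, inner_smul_right, inner_smul_left] at h2
  simp only [RCLike.conj_to_real] at h2
  have h3 : 0 ≤ 2 * (t * inner ℝ (T g - z) v) + t * (t * inner ℝ v (T v)) := by linarith
  have h4 := mul_nonneg (sq_nonneg (‖v‖ ^ 2)) h3
  have h5 : (‖v‖ ^ 2) ^ 2 * (2 * (t * inner ℝ (T g - z) v) + t * (t * inner ℝ v (T v)))
      = 4 * (s ^ 2 * inner ℝ v (T v) - s * inner ℝ (T g - z) v * ‖v‖ ^ 2) := by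
    linear_combination (2 * ‖v‖ ^ 2 * inner ℝ (T g - z) v
      + (t * ‖v‖ ^ 2 - 2 * s) * inner ℝ v (T v)) * htv
  linarith

theorem exists_multiplier {T : E →ₗ[ℝ] E} (hT : T.IsSymmetric) {z g : E} {r c : ℝ}
    (hr : 0 < r) (hg : ‖g‖ ^ 2 = r)
    (hmin : ∀ g' : E, ‖g'‖ ^ 2 = r →
      inner ℝ g (T g) - 2 * inner ℝ g z ≤ inner ℝ g' (T g') - 2 * inner ℝ g' z)
    (hc : ∀ x, inner ℝ x (T x) ≤ c * ‖x‖ ^ 2) :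
    ∃ μ : ℝ, T g + μ • g = z := by
  set w := T g - z with hw
  set μ := -(inner ℝ w g / r) with hμ
  have hμr : μ * r = -inner ℝ w g := by rw [hμ]; field_simp
  refine ⟨μ, ?_⟩
  set u := w + μ • g with hu
  have hgg : inner ℝ g g = r := by rw [real_inner_self_eq_norm_sq, hg]
  have hgu : inner ℝ g u = 0 := by
    rw [hu, inner_add_right, inner_smul_right, hgg, real_inner_comm, hμr]; ring
  have hwu : inner ℝ w u = ‖u‖ ^ 2 := by
    have h : inner ℝ (w + μ • g) u = inner ℝ w u + μ * inner ℝ g u := by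
      rw [inner_add_left, inner_smul_left, RCLike.conj_to_real]
    rw [← hu, hgu, real_inner_self_eq_norm_sq] at h
    linarith
  -- `u` is the part of `T g - z` tangent to the sphere. Reflecting along `u` itself fixes `g`, so
  -- the direction is tilted by `ε • g` and `ε` then tends to `0`.
  have key : ∀ ε : ℝ, 0 < ε → ‖u‖ ^ 2 ≤ ε * (r * (μ + c)) := by
    intro ε hε
    have h1 := reflection_inequality hT hg hmin (u + ε • g)
    have hv : ‖u + ε • g‖ ^ 2 = ‖u‖ ^ 2 + ε ^ 2 * r := by
      rw [norm_add_sq_real, inner_smul_right, real_inner_comm, hgu, norm_smul, mul_pow, hg,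
        Real.norm_eq_abs, sq_abs]
      ring
    have hs : inner ℝ g (u + ε • g) = ε * r := by
      rw [inner_add_right, hgu, inner_smul_right, hgg]; ring
    have hwv : inner ℝ w (u + ε • g) = ‖u‖ ^ 2 - ε * (μ * r) := by
      rw [inner_add_right, hwu, inner_smul_right, hμr]; ring
    have h2 := hc (u + ε • g)
    rw [← hw, hs, hwv] at h1
    have hvpos : 0 < ‖u + ε • g‖ ^ 2 := by rw [hv]; positivity
    have h3 := h1.trans (mul_le_mul_of_nonneg_left h2 (sq_nonneg (ε * r)))
    have h4 : (ε * r * ‖u + ε • g‖ ^ 2) * (‖u‖ ^ 2)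
        ≤ (ε * r * ‖u + ε • g‖ ^ 2) * (ε * (r * (μ + c))) := by linarith
    exact le_of_mul_le_mul_left h4 (by positivity)
  have hu0 : ‖u‖ ^ 2 ≤ 0 := by
    have hlim : Filter.Tendsto (fun ε : ℝ => ε * (r * (μ + c))) (nhdsWithin 0 (Set.Ioi 0))
        (nhds 0) := by
      have : Continuous (fun ε : ℝ => ε * (r * (μ + c))) := by fun_prop
      simpa using (this.tendsto 0).mono_left nhdsWithin_le_nhds
    exact ge_of_tendsto hlim (Filter.eventually_of_mem self_mem_nhdsWithin fun ε hε => key ε hε)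
  have hu1 : u = 0 := by
    have : ‖u‖ = 0 := by nlinarith [norm_nonneg u]
    simpa using this
  rw [hu, hw] at hu1
  rw [← sub_eq_zero, ← hu1]
  abel

theorem multiplier_nonneg {T : E →ₗ[ℝ] E} (hT : T.IsSymmetric) {z g : E} {r μ : ℝ}
    (hr : 0 < r) (hg : ‖g‖ ^ 2 = r)
    (hmin : ∀ g' : E, ‖g'‖ ^ 2 = r →
      inner ℝ g (T g) - 2 * inner ℝ g z ≤ inner ℝ g' (T g') - 2 * inner ℝ g' z)
    (hμ : T g + μ • g = z) {v : E} (hv : v ≠ 0) (hTv : T v = 0) : 0 ≤ μ := by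
  have hw : T g - z = -(μ • g) := by rw [← hμ]; abel
  have hgg : inner ℝ g g = r := by rw [real_inner_self_eq_norm_sq, hg]
  have key : ∀ x : E, inner ℝ g x ≠ 0 → 0 ≤ inner ℝ x (T x) + μ * ‖x‖ ^ 2 := by
    intro x hx
    have h1 := reflection_inequality hT hg hmin x
    rw [hw, inner_neg_left, inner_smul_left, RCLike.conj_to_real] at h1
    have h2 : 0 ≤ inner ℝ g x ^ 2 * (inner ℝ x (T x) + μ * ‖x‖ ^ 2) := by linarith
    exact nonneg_of_mul_nonneg_right h2 (by positivity)
  have hv2 : 0 < ‖v‖ ^ 2 := by positivity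
  -- The reflection inequality is empty when `v ⊥ g`; the same tilt by `ε • g` and a limit recover
  -- it.
  by_cases hs : inner ℝ g v = 0
  · have hlim : Filter.Tendsto (fun ε : ℝ => inner ℝ (v + ε • g) (T (v + ε • g))
        + μ * ‖v + ε • g‖ ^ 2) (nhdsWithin 0 (Set.Ioi 0)) (nhds (μ * ‖v‖ ^ 2)) := by
      have : Continuous (fun ε : ℝ => inner ℝ (v + ε • g) (T (v + ε • g))
          + μ * ‖v + ε • g‖ ^ 2) := by
        simp only [map_add, map_smul, hTv]
        fun_prop
      have h := (this.tendsto 0).mono_left (nhdsWithin_le_nhds (s := Set.Ioi 0))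
      simpa [hTv] using h
    have h := ge_of_tendsto hlim (Filter.eventually_of_mem self_mem_nhdsWithin fun ε hε => by
      refine key _ ?_
      rw [inner_add_right, hs, inner_smul_right, hgg, zero_add]
      exact (mul_pos hε hr).ne')
    exact nonneg_of_mul_nonneg_left h hv2
  · have h := key v hs
    rw [hTv, inner_zero_right, zero_add] at h
    exact nonneg_of_mul_nonneg_left h hv2

/-- Substituting `z = T g + μ • g` expands the form at `z` into `T³ + 2μT² + μ²T` evaluated at `g`,
and each extra factor `T` costs at most `c`. -/
theorem quadratic_le_of_multiplier {T : E →ₗ[ℝ] E} (hT : T.IsSymmetric)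
    (hpos : ∀ x, 0 ≤ inner ℝ x (T x)) {c : ℝ} (hc : ∀ x, inner ℝ x (T x) ≤ c * ‖x‖ ^ 2)
    (hc0 : 0 ≤ c) {z g : E} {μ : ℝ} (hμ0 : 0 ≤ μ) (hμ : T g + μ • g = z)
    (hzg : ‖z‖ ^ 2 = ‖g‖ ^ 2) (hg : 0 < ‖g‖ ^ 2) :
    inner ℝ z (T z) ≤ (c + 1) ^ 2 * inner ℝ g (T g) := by
  have h1 := hT.norm_sq_apply_le hpos hc hc0 g
  have h2 := hc (T g)
  have ha := hpos g
  have hb : inner ℝ g (T (T g)) = ‖T g‖ ^ 2 := by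
    rw [← hT g (T g), real_inner_self_eq_norm_sq]
  have hb' : inner ℝ (T g) (T g) = ‖T g‖ ^ 2 := real_inner_self_eq_norm_sq _
  have hz : inner ℝ z (T z) = inner ℝ (T g) (T (T g)) + 2 * μ * ‖T g‖ ^ 2
      + μ ^ 2 * inner ℝ g (T g) := by
    rw [← hμ]
    simp only [map_add, map_smul, inner_add_left, inner_add_right, inner_smul_left,
      inner_smul_right, hb, hb', RCLike.conj_to_real]
    ring
  have hμ1 : μ ≤ 1 := by
    have h3 : ‖z‖ ^ 2 = ‖T g‖ ^ 2 + 2 * μ * inner ℝ g (T g) + μ ^ 2 * ‖g‖ ^ 2 := by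
      rw [← hμ, norm_add_sq_real, inner_smul_right, real_inner_comm, norm_smul, mul_pow,
        Real.norm_eq_abs, sq_abs]
      ring
    have h4 : μ ^ 2 * ‖g‖ ^ 2 ≤ 1 * ‖g‖ ^ 2 := by
      have := mul_nonneg hμ0 ha
      nlinarith [sq_nonneg ‖T g‖]
    have h5 := le_of_mul_le_mul_right h4 hg
    nlinarith
  calc inner ℝ z (T z) ≤ (c + μ) ^ 2 * inner ℝ g (T g) := by
        rw [hz]
        have := mul_le_mul_of_nonneg_left h1 hc0
        have := mul_le_mul_of_nonneg_left h1 hμ0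
        nlinarith
    _ ≤ _ := by gcongr

/-- Solvability of the trust-region problem on a sphere, with a comparison of quadratic forms. -/
theorem exists_unique_trust_region_solution [FiniteDimensional ℝ E] {T : E →ₗ[ℝ] E}
    (hT : T.IsSymmetric)
    (hpos : ∀ x, 0 ≤ inner ℝ x (T x)) {c : ℝ} (hc : ∀ x, inner ℝ x (T x) ≤ c * ‖x‖ ^ 2)
    (hc0 : 0 ≤ c) {z v : E} {r : ℝ} (hr : 0 < r) (hz : ‖z‖ ^ 2 = r) (hv : v ≠ 0) (hTv : T v = 0)
    (hne : ∀ g, ‖g‖ ^ 2 = r → T g ≠ z) :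
    ∃ g : E, (‖g‖ ^ 2 = r ∧ ∀ g' : E, ‖g'‖ ^ 2 = r →
        inner ℝ g (T g) - 2 * inner ℝ g z ≤ inner ℝ g' (T g') - 2 * inner ℝ g' z) ∧
      (∀ g₁ : E, (‖g₁‖ ^ 2 = r ∧ ∀ g' : E, ‖g'‖ ^ 2 = r →
        inner ℝ g₁ (T g₁) - 2 * inner ℝ g₁ z ≤ inner ℝ g' (T g') - 2 * inner ℝ g' z) → g₁ = g) ∧
      inner ℝ z (T z) ≤ (c + 1) ^ 2 * inner ℝ g (T g) := by
  have : ProperSpace E := FiniteDimensional.proper ℝ E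
  have hcomp : IsCompact {g : E | ‖g‖ ^ 2 = r} := by
    refine (isCompact_closedBall (0 : E) (√r)).of_isClosed_subset
      (isClosed_eq (by fun_prop) continuous_const) fun g hg => ?_
    rw [mem_closedBall_zero_iff]
    exact Real.le_sqrt_of_sq_le (le_of_eq hg)
  have hTc : Continuous T := T.continuous_of_finiteDimensional
  obtain ⟨g, hg, hgmin⟩ := hcomp.exists_isMinOn ⟨z, hz⟩
    (f := fun g => inner ℝ g (T g) - 2 * inner ℝ g z) (by fun_prop)
  have hmin : ∀ g' : E, ‖g'‖ ^ 2 = r →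
      inner ℝ g (T g) - 2 * inner ℝ g z ≤ inner ℝ g' (T g') - 2 * inner ℝ g' z :=
    fun g' hg' => hgmin hg'
  have hg : ‖g‖ ^ 2 = r := hg
  obtain ⟨μ, hμ⟩ := exists_multiplier hT hr hg hmin hc
  have hμ0 := multiplier_nonneg hT hr hg hmin hμ hv hTv
  have hμpos : 0 < μ := by
    refine lt_of_le_of_ne hμ0 fun h0 => hne g hg ?_
    rw [← hμ, ← h0]; simp
  refine ⟨g, ⟨hg, hmin⟩, fun g₁ ⟨hg₁, hmin₁⟩ => ?_,
    quadratic_le_of_multiplier hT hpos hc hc0 hμ0 hμ (by rw [hz, hg]) (by rw [hg]; exact hr)⟩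
  -- As `g` and `g + d` have equal norm, `2⟨g, d⟩ = -‖d‖²`, so the objective grows by `μ‖d‖² + ⟨d, T
  -- d⟩`.
  have h1 := hmin₁ g hg
  obtain ⟨d, rfl⟩ : ∃ d, g₁ = g + d := ⟨g₁ - g, by abel⟩
  rw [quadratic_add T hT] at h1
  have hw : T g - z = -(μ • g) := by rw [← hμ]; abel
  rw [norm_add_sq_real, hg] at hg₁
  rw [hw, inner_neg_left, inner_smul_left, RCLike.conj_to_real] at h1
  have h2 := hpos d
  have h3 : μ * ‖d‖ ^ 2 ≤ 0 := by
    have : inner ℝ g d = -(‖d‖ ^ 2) / 2 := by linarith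
    rw [this] at h1
    linarith
  have h4 : ‖d‖ ^ 2 ≤ 0 := nonpos_of_mul_nonpos_right h3 hμpos
  have h5 : ‖d‖ = 0 := by nlinarith [norm_nonneg d]
  rw [norm_eq_zero.1 h5, add_zero]

end TrustRegion

/-! ### Spectral bound for the nearest neighbour graph. -/

namespace ModuloDenoise

open Real Finset

/-- Each distance `d ≤ k` gives at most one neighbour on either side. Nonnegativity of `p` and `q`
pays for neighbours missing near the ends. -/
theorem sum_nnGraph_adj_le {n k : ℕ} (i : Fin n) (F : Fin n → ℝ) (p q : ℕ → ℝ)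
    (hp : ∀ d, 1 ≤ d → 0 ≤ p d) (hq : ∀ d, 1 ≤ d → 0 ≤ q d)
    (hFp : ∀ j, i < j → F j ≤ p ((j : ℕ) - i)) (hFq : ∀ j, j < i → F j ≤ q ((i : ℕ) - j)) :
    ∑ j, (if (nnGraph n k).Adj i j then F j else 0) ≤ ∑ d ∈ Icc 1 k, (p d + q d) := by
  have hsplit : ∀ j, (if (nnGraph n k).Adj i j then F j else 0)
      = (if (i < j ∧ (j : ℕ) - i ≤ k) then F j else 0)
        + (if (j < i ∧ (i : ℕ) - j ≤ k) then F j else 0) := by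
    intro j
    have hadj : (nnGraph n k).Adj i j ↔ i ≠ j ∧ |((i : ℕ) : ℤ) - ((j : ℕ) : ℤ)| ≤ (k : ℤ) :=
      Iff.rfl
    rcases lt_trichotomy i j with h | h | h
    · have h' : ((nnGraph n k).Adj i j) ↔ (i < j ∧ (j : ℕ) - i ≤ k) := by
        have := Fin.lt_def.1 h
        rw [hadj, abs_le]
        simp only [h, h.ne, ne_eq, not_false_iff, true_and]
        omega
      simp only [h', h.not_gt, false_and, if_false, add_zero]
    · subst h
      simp
    · have h' : ((nnGraph n k).Adj i j) ↔ (j < i ∧ (i : ℕ) - j ≤ k) := by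
        have := Fin.lt_def.1 h
        rw [hadj, abs_le]
        simp only [h, h.ne', ne_eq, not_false_iff, true_and]
        omega
      simp only [h', h.not_gt, false_and, if_false, zero_add]
  simp only [hsplit, sum_add_distrib, ← sum_filter]
  refine add_le_add ?_ ?_
  · refine (sum_le_sum fun j hj => hFp j (mem_filter.1 hj).2.1).trans ?_
    rw [← sum_image (s := univ.filter fun j : Fin n => i < j ∧ (j : ℕ) - i ≤ k)
      (g := fun j : Fin n => (j : ℕ) - i) (f := p)]
    · refine sum_le_sum_of_subset_of_nonneg (fun d hd => ?_) fun d hd _ => hp d (mem_Icc.1 hd).1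
      obtain ⟨j, hj, rfl⟩ := mem_image.1 hd
      have hj := (mem_filter.1 hj).2
      have := Fin.lt_def.1 hj.1
      exact mem_Icc.2 ⟨by omega, hj.2⟩
    · intro a ha b hb hab
      have ha := Fin.lt_def.1 (mem_filter.1 ha).2.1
      have hb := Fin.lt_def.1 (mem_filter.1 hb).2.1
      ext
      dsimp only at hab
      omega
  · refine (sum_le_sum fun j hj => hFq j (mem_filter.1 hj).2.1).trans ?_
    rw [← sum_image (s := univ.filter fun j : Fin n => j < i ∧ (i : ℕ) - j ≤ k)
      (g := fun j : Fin n => (i : ℕ) - j) (f := q)]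
    · refine sum_le_sum_of_subset_of_nonneg (fun d hd => ?_) fun d hd _ => hq d (mem_Icc.1 hd).1
      obtain ⟨j, hj, rfl⟩ := mem_image.1 hd
      have hj := (mem_filter.1 hj).2
      have := Fin.lt_def.1 hj.1
      exact mem_Icc.2 ⟨by omega, hj.2⟩
    · intro a ha b hb hab
      have ha := Fin.lt_def.1 (mem_filter.1 ha).2.1
      have hb := Fin.lt_def.1 (mem_filter.1 hb).2.1
      ext
      dsimp only at hab
      omega

/-- The top eigenvector, up to alternating signs, of the Laplacian of the path on `n` vertices. -/
noncomputable def pathWeight (n : ℕ) (t : ℝ) : ℝ := sin (π * (2 * t + 1) / (2 * n))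

theorem pathWeight_pos {n m : ℕ} (hm : m < n) : 0 < pathWeight n m := by
  have hn : (0 : ℝ) < n := by exact_mod_cast (Nat.zero_le m).trans_lt hm
  have hm' : (m : ℝ) + 1 ≤ n := by exact_mod_cast hm
  refine sin_pos_of_pos_of_lt_pi (by positivity) ?_
  rw [div_lt_iff₀ (by positivity)]
  exact mul_lt_mul_of_pos_left (by linarith) pi_pos

/-- The range includes the ghost positions `-1` and `n`, where the weight is the negative of that of
the adjacent end vertex and the sum vanishes. Hence a missing neighbour never lowers the bound. -/
theorem pathWeight_add_succ_nonneg {n : ℕ} (hn : 1 ≤ n) {t : ℝ} (ht : -1 ≤ t)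
    (htn : t + 1 ≤ n) : 0 ≤ pathWeight n t + pathWeight n (t + 1) := by
  have hn0 : (1 : ℝ) ≤ n := by exact_mod_cast hn
  have h1 : pathWeight n t + pathWeight n (t + 1)
      = 2 * sin (π * (t + 1) / n) * cos (π / (2 * n)) := by
    have e1 : π * (2 * t + 1) / (2 * n) = π * (t + 1) / n - π / (2 * n) := by field_simp; ring
    have e2 : π * (2 * (t + 1) + 1) / (2 * n) = π * (t + 1) / n + π / (2 * n) := by
      field_simp
    rw [pathWeight, pathWeight, e1, e2, sin_sub, sin_add]
    ring
  rw [h1]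
  have hs : 0 ≤ sin (π * (t + 1) / n) := by
    refine sin_nonneg_of_nonneg_of_le_pi ?_ ?_
    · exact div_nonneg (mul_nonneg pi_pos.le (by linarith)) (by linarith)
    · rw [div_le_iff₀ (by linarith)]
      exact mul_le_mul_of_nonneg_left htn pi_pos.le
  have hc : 0 ≤ cos (π / (2 * n)) := by
    refine cos_nonneg_of_mem_Icc ⟨?_, ?_⟩
    · have : 0 ≤ π / (2 * n) := by positivity
      linarith [pi_pos]
    · rw [div_le_div_iff₀ (by linarith) (by norm_num)]
      exact mul_le_mul_of_nonneg_left (by linarith) pi_pos.le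
  positivity

theorem pathWeight_eigen {n : ℕ} (hn : 1 ≤ n) (t : ℝ) :
    2 * pathWeight n t + (pathWeight n (t - 1) + pathWeight n (t + 1))
      = 4 * cos (π / (2 * n)) ^ 2 * pathWeight n t := by
  have hn0 : (1 : ℝ) ≤ n := by exact_mod_cast hn
  have e1 : π * (2 * (t - 1) + 1) / (2 * n) = π * (2 * t + 1) / (2 * n) - 2 * (π / (2 * n)) := by
    field_simp; ring
  have e2 : π * (2 * (t + 1) + 1) / (2 * n) = π * (2 * t + 1) / (2 * n) + 2 * (π / (2 * n)) := by
    field_simp; ring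
  rw [pathWeight, pathWeight, pathWeight, e1, e2, sin_sub, sin_add, cos_two_mul]
  ring

/-- The weight of the vertex `i` on the path through the residue class of `i` modulo `|i - j|`. -/
noncomputable def edgeWeight {n : ℕ} (i j : Fin n) : ℝ :=
  pathWeight n (((i : ℕ) / (((i : ℕ) - j) + ((j : ℕ) - i)) : ℕ) : ℝ)

theorem edgeWeight_pos {n : ℕ} (i j : Fin n) : 0 < edgeWeight i j :=
  pathWeight_pos ((Nat.div_le_self _ _).trans_lt i.2)

/-- Vertices at distance `d` are consecutive on a path in a residue class mod `d`, at positions `i /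
d` and `i / d ± 1`. The eigenvector equation makes each `d` contribute `4 cos²(π/2n)`. In
`edgeWeight` one truncated difference is zero, so their sum is `|i - j|`. -/
theorem sum_edgeWeight_le {n k : ℕ} (hn : 1 ≤ n) (i : Fin n) :
    ∑ j, (if (nnGraph n k).Adj i j then 1 + edgeWeight j i / edgeWeight i j else 0)
      ≤ k * (4 * cos (π / (2 * n)) ^ 2) := by
  have hw : ∀ d, 0 < pathWeight n (((i : ℕ) / d : ℕ) : ℝ) := fun d =>
    pathWeight_pos ((Nat.div_le_self _ _).trans_lt i.2)
  have hle : ∀ d, ((((i : ℕ) / d : ℕ) : ℝ)) + 1 ≤ n := fun d => by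
    exact_mod_cast (Nat.div_le_self _ _).trans_lt i.2
  refine (sum_nnGraph_adj_le i _
    (fun d => 1 + pathWeight n ((((i : ℕ) / d : ℕ) : ℝ) + 1) / pathWeight n (((i : ℕ) / d : ℕ) : ℝ))
    (fun d => 1 + pathWeight n ((((i : ℕ) / d : ℕ) : ℝ) - 1) / pathWeight n (((i : ℕ) / d : ℕ) : ℝ))
    ?_ ?_ ?_ ?_).trans ?_
  · intro d _
    have h := pathWeight_add_succ_nonneg hn
      (t := (((i : ℕ) / d : ℕ) : ℝ)) (by linarith [Nat.cast_nonneg (α := ℝ) ((i : ℕ) / d)]) (hle d)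
    rw [one_add_div (hw d).ne']
    exact div_nonneg h (hw d).le
  · intro d _
    have h := pathWeight_add_succ_nonneg hn
      (t := (((i : ℕ) / d : ℕ) : ℝ) - 1) (by linarith [Nat.cast_nonneg (α := ℝ) ((i : ℕ) / d)])
      (by linarith [hle d])
    rw [sub_add_cancel, add_comm] at h
    rw [one_add_div (hw d).ne']
    exact div_nonneg h (hw d).le
  · intro j hij
    have hij' := Fin.lt_def.1 hij
    have e1 : ((i : ℕ) - j) + ((j : ℕ) - i) = (j : ℕ) - i := by omega
    have e2 : ((j : ℕ) - i) + ((i : ℕ) - j) = (j : ℕ) - i := by omega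
    have e3 : (j : ℕ) / ((j : ℕ) - i) = (i : ℕ) / ((j : ℕ) - i) + 1 := by
      rw [← Nat.add_div_right _ (by omega)]
      congr 1; omega
    rw [edgeWeight, edgeWeight, e1, e2, e3, Nat.cast_add, Nat.cast_one]
  · intro j hij
    have hij' := Fin.lt_def.1 hij
    have e1 : ((i : ℕ) - j) + ((j : ℕ) - i) = (i : ℕ) - j := by omega
    have e2 : ((j : ℕ) - i) + ((i : ℕ) - j) = (i : ℕ) - j := by omega
    have e3 : (i : ℕ) / ((i : ℕ) - j) = (j : ℕ) / ((i : ℕ) - j) + 1 := by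
      rw [← Nat.add_div_right _ (by omega)]
      congr 1; omega
    rw [edgeWeight, edgeWeight, e1, e2, e3, Nat.cast_add, Nat.cast_one, add_sub_cancel_right]
  · refine le_of_eq ?_
    rw [sum_congr rfl (g := fun _ => 4 * cos (π / (2 * n)) ^ 2) fun d _ => ?_]
    · simp
    · have h := pathWeight_eigen hn ((((i : ℕ) / d : ℕ) : ℝ))
      have h0 := (hw d).ne'
      field_simp
      linarith

/-- Equality holds when `x : y = a : -b`, which is why positive weights can encode an eigenvector
with alternating signs. -/
theorem sub_sq_le_weighted {a b : ℝ} (ha : 0 < a) (hb : 0 < b) (x y : ℝ) :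
    (x - y) ^ 2 ≤ (1 + b / a) * x ^ 2 + (1 + a / b) * y ^ 2 := by
  have h : (1 + b / a) * x ^ 2 + (1 + a / b) * y ^ 2 - (x - y) ^ 2
      = (b * x + a * y) ^ 2 / (a * b) := by
    field_simp
    ring
  have : 0 ≤ (b * x + a * y) ^ 2 / (a * b) := by positivity
  linarith

/-- The largest Laplacian eigenvalue is at most `4 k cos² (π / 2n)`. -/
theorem sum_nnGraph_sub_sq_le {n k : ℕ} (hn : 1 ≤ n) (x : Fin n → ℝ) :
    (∑ i, ∑ j, if (nnGraph n k).Adj i j then (x i - x j) ^ 2 else 0) / 2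
      ≤ k * (4 * cos (π / (2 * n)) ^ 2) * ∑ i, x i ^ 2 := by
  set A : Fin n → Fin n → ℝ := fun i j =>
    if (nnGraph n k).Adj i j then 1 + edgeWeight j i / edgeWeight i j else 0 with hA
  have h1 : ∀ i j, (if (nnGraph n k).Adj i j then (x i - x j) ^ 2 else 0)
      ≤ A i j * x i ^ 2 + A j i * x j ^ 2 := by
    intro i j
    by_cases h : (nnGraph n k).Adj i j
    · simp only [hA, h, h.symm, if_true]
      exact sub_sq_le_weighted (edgeWeight_pos i j) (edgeWeight_pos j i) _ _
    · have h' : ¬ (nnGraph n k).Adj j i := fun h' => h h'.symm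
      simp [hA, h, h']
  have h2 : ∑ i, ∑ j, (if (nnGraph n k).Adj i j then (x i - x j) ^ 2 else 0)
      ≤ 2 * ∑ i, ∑ j, A i j * x i ^ 2 := by
    refine (sum_le_sum fun i _ => sum_le_sum fun j _ => h1 i j).trans (le_of_eq ?_)
    simp only [sum_add_distrib]
    rw [sum_comm (f := fun i j => A j i * x j ^ 2)]
    ring
  have h3 : ∑ i, ∑ j, A i j * x i ^ 2 ≤ k * (4 * cos (π / (2 * n)) ^ 2) * ∑ i, x i ^ 2 := by
    rw [mul_sum]
    refine sum_le_sum fun i _ => ?_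
    rw [← sum_mul]
    exact mul_le_mul_of_nonneg_right (sum_edgeWeight_le hn i) (sq_nonneg _)
  linarith

end ModuloDenoise

/-! ### The form of `H`, smoothness of the clean signal, and the correlation bound. -/

namespace ModuloDenoise

open Real Finset

theorem quadForm_regMatrix (n k : ℕ) (lam : ℝ) (g : EuclideanSpace ℝ (Fin n ⊕ Fin n)) :
    quadForm (regMatrix n k lam) g
      = lam * ((∑ i, ∑ j, if (nnGraph n k).Adj i j
            then (g (Sum.inl i) - g (Sum.inl j)) ^ 2 else 0) / 2
          + (∑ i, ∑ j, if (nnGraph n k).Adj i j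
            then (g (Sum.inr i) - g (Sum.inr j)) ^ 2 else 0) / 2) := by
  rw [← (nnGraph n k).lapMatrix_toLinearMap₂' ℝ (fun i => g (Sum.inl i)),
    ← (nnGraph n k).lapMatrix_toLinearMap₂' ℝ (fun i => g (Sum.inr i)),
    Matrix.toLinearMap₂'_apply', Matrix.toLinearMap₂'_apply', quadForm,
    EuclideanSpace.inner_eq_star_dotProduct, Matrix.ofLp_toLpLin, Matrix.toLin'_apply, star_trivial,
    dotProduct_comm, regMatrix, Matrix.fromBlocks_mulVec]
  simp only [Matrix.smul_mulVec, Matrix.zero_mulVec, add_zero, zero_add, dotProduct,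
    Fintype.sum_sum_type, Sum.elim_inl, Sum.elim_inr, Pi.smul_apply, smul_eq_mul, mul_add, mul_sum,
    Function.comp_def]
  congr 1 <;> exact sum_congr rfl fun i _ => by ring

theorem isSymmetric_regMatrix (n k : ℕ) (lam : ℝ) :
    (Matrix.toEuclideanLin (regMatrix n k lam)).IsSymmetric := by
  rw [Matrix.isSymmetric_toEuclideanLin_iff, regMatrix]
  have h : (lam • (nnGraph n k).lapMatrix ℝ).IsHermitian :=
    ((nnGraph n k).isHermitian_lapMatrix ℝ).smul (IsSelfAdjoint.all lam)
  exact h.fromBlocks (by simp) h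

theorem quadForm_regMatrix_nonneg (n k : ℕ) {lam : ℝ} (hlam : 0 ≤ lam)
    (g : EuclideanSpace ℝ (Fin n ⊕ Fin n)) : 0 ≤ quadForm (regMatrix n k lam) g := by
  rw [quadForm_regMatrix]
  have h : ∀ x : Fin n → ℝ,
      0 ≤ (∑ i, ∑ j, if (nnGraph n k).Adj i j then (x i - x j) ^ 2 else 0) / 2 := fun x => by
    refine div_nonneg (sum_nonneg fun i _ => sum_nonneg fun j _ => ?_) (by norm_num)
    split_ifs <;> positivity
  exact mul_nonneg hlam (add_nonneg (h _) (h _))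

theorem quadForm_regMatrix_le {n : ℕ} (hn : 1 ≤ n) (k : ℕ) {lam : ℝ} (hlam : 0 ≤ lam)
    (g : EuclideanSpace ℝ (Fin n ⊕ Fin n)) :
    quadForm (regMatrix n k lam) g ≤ 4 * lam * k * cos (π / (2 * n)) ^ 2 * ‖g‖ ^ 2 := by
  rw [quadForm_regMatrix, EuclideanSpace.norm_sq_eq, Fintype.sum_sum_type]
  simp only [Real.norm_eq_abs, sq_abs]
  have h := mul_le_mul_of_nonneg_left
    (add_le_add (sum_nnGraph_sub_sq_le (k := k) hn fun i => g (Sum.inl i))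
      (sum_nnGraph_sub_sq_le (k := k) hn fun i => g (Sum.inr i))) hlam
  refine h.trans (le_of_eq ?_)
  ring

theorem exists_ne_zero_regMatrix_apply_eq_zero {n : ℕ} (hn : 1 ≤ n) (k : ℕ) (lam : ℝ) :
    ∃ v : EuclideanSpace ℝ (Fin n ⊕ Fin n), v ≠ 0 ∧
      Matrix.toEuclideanLin (regMatrix n k lam) v = 0 := by
  refine ⟨WithLp.toLp 2 (Sum.elim (fun _ => 1) (fun _ => 1)), fun h => ?_, ?_⟩
  · have := congrArg (fun v : EuclideanSpace ℝ (Fin n ⊕ Fin n) => v (Sum.inl ⟨0, hn⟩)) h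
    simp at this
  · rw [Matrix.toLpLin_toLp, Matrix.toLin'_apply, regMatrix, Matrix.fromBlocks_mulVec]
    simp [Matrix.smul_mulVec, SimpleGraph.lapMatrix_mulVec_const_eq_zero, Function.comp_def]

theorem norm_realify_sq {n : ℕ} {g : Fin n → ℂ} (hg : ∀ i, ‖g i‖ = 1) :
    ‖realify g‖ ^ 2 = n := by
  rw [EuclideanSpace.norm_sq_eq, Fintype.sum_sum_type, ← sum_add_distrib]
  have h : ∀ i, ‖realify g (Sum.inl i)‖ ^ 2 + ‖realify g (Sum.inr i)‖ ^ 2 = 1 := fun i => by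
    have := Complex.sq_norm (g i)
    rw [hg, Complex.normSq_apply] at this
    simp only [realify, Sum.elim_inl, Sum.elim_inr, Real.norm_eq_abs, sq_abs]
    linarith
  rw [sum_congr rfl fun i _ => h i]
  simp

theorem norm_exp_two_pi_mul_I (t : ℝ) : ‖Complex.exp (2 * π * Complex.I * (t : ℂ))‖ = 1 := by
  rw [show 2 * π * Complex.I * (t : ℂ) = ((2 * π * t : ℝ) : ℂ) * Complex.I by push_cast; ring,
    Complex.norm_exp_ofReal_mul_I]

theorem norm_exp_two_pi_mul_I_sub_le (s t : ℝ) :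
    ‖Complex.exp (2 * π * Complex.I * (s : ℂ)) - Complex.exp (2 * π * Complex.I * (t : ℂ))‖
      ≤ 2 * π * |s - t| := by
  have h : Complex.exp (2 * π * Complex.I * (s : ℂ)) - Complex.exp (2 * π * Complex.I * (t : ℂ))
      = Complex.exp (2 * π * Complex.I * (t : ℂ))
        * (Complex.exp (Complex.I * ((2 * π * (s - t) : ℝ) : ℂ)) - 1) := by
    rw [mul_sub, ← Complex.exp_add, mul_one]
    congr 2
    push_cast
    ring
  rw [h, norm_mul, norm_exp_two_pi_mul_I, one_mul]
  refine Real.norm_exp_I_mul_ofReal_sub_one_le.trans (le_of_eq ?_)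
  rw [Real.norm_eq_abs, abs_mul, abs_of_pos two_pi_pos]

theorem norm_cleanSignal_sub_sq_le {n k : ℕ} (hn : 2 ≤ n) {M α : ℝ} (hM : 0 ≤ M) (hα : 0 ≤ α)
    {f : ℝ → ℝ}
    (hf : ∀ x ∈ Set.Icc (0 : ℝ) 1, ∀ y ∈ Set.Icc (0 : ℝ) 1, |f x - f y| ≤ M * |x - y| ^ α)
    {i j : Fin n} (hij : (nnGraph n k).Adj i j) :
    ‖cleanSignal n f i - cleanSignal n f j‖ ^ 2
      ≤ 4 * π ^ 2 * M ^ 2 * (2 * (k : ℝ) / n) ^ (2 * α) := by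
  have hn2 : (2 : ℝ) ≤ n := by exact_mod_cast hn
  have hn1 : (0 : ℝ) < n - 1 := by linarith
  have hgrid : ∀ i : Fin n, grid n i ∈ Set.Icc (0 : ℝ) 1 := fun i => by
    have : ((i : ℕ) : ℝ) + 1 ≤ n := by exact_mod_cast i.2
    refine ⟨by unfold grid; positivity, ?_⟩
    rw [grid, div_le_one hn1]
    linarith
  -- The factor 2 comes from `1 / (n - 1) ≤ 2 / n`, valid for `n ≥ 2`.
  have hd : |grid n i - grid n j| ≤ 2 * (k : ℝ) / n := by
    have h1 : |((i : ℕ) : ℝ) - ((j : ℕ) : ℝ)| ≤ k := by exact_mod_cast hij.2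
    rw [grid, grid, ← sub_div, abs_div, abs_of_pos hn1, div_le_div_iff₀ hn1 (by linarith)]
    have h2 : (0 : ℝ) ≤ k := Nat.cast_nonneg k
    calc _ ≤ (k : ℝ) * n := by gcongr
      _ ≤ _ := by nlinarith
  have hk : (0 : ℝ) ≤ 2 * (k : ℝ) / n := by positivity
  calc _ ≤ (2 * π * (M * (2 * (k : ℝ) / n) ^ α)) ^ 2 := by
        gcongr
        refine (norm_exp_two_pi_mul_I_sub_le _ _).trans ?_
        gcongr
        refine (hf _ (hgrid i) _ (hgrid j)).trans ?_
        gcongr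
    _ = _ := by
        rw [mul_comm 2 α, rpow_mul hk, rpow_two]
        ring

theorem quadForm_cleanSignal_le {n k : ℕ} (hn : 2 ≤ n) {lam M α : ℝ} (hlam : 0 ≤ lam)
    (hM : 0 ≤ M) (hα : 0 ≤ α) {f : ℝ → ℝ}
    (hf : ∀ x ∈ Set.Icc (0 : ℝ) 1, ∀ y ∈ Set.Icc (0 : ℝ) 1, |f x - f y| ≤ M * |x - y| ^ α) :
    quadForm (regMatrix n k lam) (realify (cleanSignal n f))
      ≤ 2 * n * (lam * π ^ 2 * M ^ 2 * (2 * (k : ℝ)) ^ (2 * α + 1) / (n : ℝ) ^ (2 * α)) := by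
  set B := 4 * π ^ 2 * M ^ 2 * (2 * (k : ℝ) / n) ^ (2 * α) with hB
  have hB0 : 0 ≤ B := by positivity
  have hrow : ∀ i : Fin n, ∑ j, (if (nnGraph n k).Adj i j then B else 0) ≤ 2 * k * B := by
    intro i
    refine (sum_nnGraph_adj_le i (fun _ => B) (fun _ => B) (fun _ => B) (fun _ _ => hB0)
      (fun _ _ => hB0) (fun _ _ => le_rfl) fun _ _ => le_rfl).trans (le_of_eq ?_)
    simp
    ring
  have h1 : quadForm (regMatrix n k lam) (realify (cleanSignal n f))
      ≤ lam * ((∑ i : Fin n, ∑ j, if (nnGraph n k).Adj i j then B else 0) / 2) := by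
    rw [quadForm_regMatrix, ← add_div, ← sum_add_distrib]
    gcongr with i _
    rw [← sum_add_distrib]
    gcongr with j _
    split_ifs with hij
    · refine le_trans (le_of_eq ?_) (norm_cleanSignal_sub_sq_le hn hM hα hf hij)
      rw [Complex.sq_norm, Complex.normSq_apply]
      simp only [realify, Sum.elim_inl, Sum.elim_inr, Complex.sub_re, Complex.sub_im]
      ring
    · simp
  have h2 : ∑ i : Fin n, ∑ j, (if (nnGraph n k).Adj i j then B else 0) ≤ n * (2 * k * B) := by
    refine (sum_le_sum fun i _ => hrow i).trans (le_of_eq ?_)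
    simp
  have hn0 : (0 : ℝ) < n := by exact_mod_cast (by omega : 0 < n)
  refine h1.trans ((mul_le_mul_of_nonneg_left (div_le_div_of_nonneg_right h2 (by norm_num))
    hlam).trans (le_of_eq ?_))
  rw [hB, div_rpow (by positivity) hn0.le]
  -- Splitting the exponent `2α + 1` needs a nonzero base.
  rcases Nat.eq_zero_or_pos k with rfl | hk
  · rw [Nat.cast_zero, mul_zero, zero_rpow (by linarith : 2 * α + 1 ≠ 0)]
    simp
  · rw [rpow_add_one (by positivity)]
    ring

/-- Write `⟨h, g⟩ = ⟨z, g⟩ - ⟨z - h, g⟩`. Minimality bounds the first term using `⟨h, z⟩ ≥ n(1 -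
δ²/2)`; Cauchy–Schwarz bounds the second by `δn`. Then `δ² ≤ δ` yields `3δ/2`. -/
theorem inner_solution_ge {n : ℕ} {H : Matrix (Fin n ⊕ Fin n) (Fin n ⊕ Fin n) ℝ}
    {h z g : EuclideanSpace ℝ (Fin n ⊕ Fin n)} {δ : ℝ} (hδ : δ ∈ Set.Icc (0 : ℝ) 1)
    (hh : ‖h‖ ^ 2 = n) (hz : ‖z‖ ^ 2 = n) (hzh : ‖z - h‖ ≤ δ * √(n : ℝ))
    (hg : IsSolution H z g) :
    n * (1 - 3 * δ / 2) - quadForm H h / 2 + quadForm H g / 2 ≤ inner ℝ h g := by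
  have hn : (0 : ℝ) ≤ n := Nat.cast_nonneg n
  have hs := Real.sq_sqrt hn
  have h1 := hg.2 h hh
  rw [objective, objective] at h1
  have h2 : ‖z - h‖ ^ 2 ≤ δ ^ 2 * n := by
    calc _ ≤ (δ * √(n : ℝ)) ^ 2 := by gcongr
      _ = _ := by rw [mul_pow, hs]
  rw [norm_sub_sq_real, hz, hh, real_inner_comm] at h2
  have h3 : inner ℝ (z - h) g ≤ δ * n := by
    have hgn : ‖g‖ = √(n : ℝ) := by rw [← hg.1, Real.sqrt_sq (norm_nonneg g)]
    calc _ ≤ ‖z - h‖ * ‖g‖ := real_inner_le_norm _ _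
      _ ≤ δ * √(n : ℝ) * √(n : ℝ) := by rw [hgn]; gcongr
      _ = _ := by rw [mul_assoc, Real.mul_self_sqrt hn]
  rw [inner_sub_left, real_inner_comm] at h3
  have h4 : δ ^ 2 * n ≤ δ * n := by
    have := mul_nonneg hδ.1 (sub_nonneg.2 hδ.2)
    gcongr
    nlinarith
  linarith

/-- The free constant `C` serves both cases: the first replaces `cos²` by `1`, the second keeps it
as `1 - sin²`. -/
theorem exists_solution_of_forall_ne {n k : ℕ} (hn : 2 ≤ n) {lam M α : ℝ} (hlam : 0 ≤ lam)
    (hM : 0 ≤ M) (hα : 0 ≤ α) {f : ℝ → ℝ}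
    (hf : ∀ x ∈ Set.Icc (0 : ℝ) 1, ∀ y ∈ Set.Icc (0 : ℝ) 1, |f x - f y| ≤ M * |x - y| ^ α)
    {δ : ℝ} (hδ : δ ∈ Set.Icc (0 : ℝ) 1) {z : EuclideanSpace ℝ (Fin n ⊕ Fin n)}
    (hz : ‖z‖ ^ 2 = n) (hzh : ‖z - realify (cleanSignal n f)‖ ≤ δ * √(n : ℝ))
    (hne : ∀ g : EuclideanSpace ℝ (Fin n ⊕ Fin n), ‖g‖ ^ 2 = n →
      Matrix.toEuclideanLin (regMatrix n k lam) g ≠ z)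
    {C : ℝ} (hC : 1 + 4 * lam * k * cos (π / (2 * n)) ^ 2 ≤ C) :
    ∃ g, IsSolution (regMatrix n k lam) z g ∧
      (∀ g', IsSolution (regMatrix n k lam) z g' → g' = g) ∧
      1 - 3 * δ / 2 - lam * π ^ 2 * M ^ 2 * (2 * (k : ℝ)) ^ (2 * α + 1) / (n : ℝ) ^ (2 * α)
          + 1 / C ^ 2 * (1 / (2 * n) * quadForm (regMatrix n k lam) z)
        ≤ 1 / (n : ℝ) * inner ℝ (realify (cleanSignal n f)) g := by
  have hn0 : (0 : ℝ) < n := by exact_mod_cast (by omega : 0 < n)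
  have hc0 : 0 ≤ 4 * lam * k * cos (π / (2 * n)) ^ 2 := by positivity
  obtain ⟨v, hv, hTv⟩ := exists_ne_zero_regMatrix_apply_eq_zero (by omega : 1 ≤ n) k lam
  obtain ⟨g, hg, hu, hq⟩ := exists_unique_trust_region_solution (isSymmetric_regMatrix n k lam)
    (quadForm_regMatrix_nonneg n k hlam)
    (quadForm_regMatrix_le (by omega) k hlam) hc0 hn0 hz hv hTv hne
  refine ⟨g, hg, hu, ?_⟩
  have h1 := inner_solution_ge hδ (norm_realify_sq (g := cleanSignal n f)
    fun i => norm_exp_two_pi_mul_I _) hz hzh hg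
  have h2 := quadForm_cleanSignal_le (k := k) hn hlam hM hα hf
  set S := lam * π ^ 2 * M ^ 2 * (2 * (k : ℝ)) ^ (2 * α + 1) / (n : ℝ) ^ (2 * α)
  have hq : quadForm (regMatrix n k lam) z ≤ C ^ 2 * quadForm (regMatrix n k lam) g := by
    refine hq.trans (mul_le_mul_of_nonneg_right ?_ (quadForm_regMatrix_nonneg n k hlam g))
    exact pow_le_pow_left₀ (by positivity) (by linarith) 2
  have hCpos : 0 < C := by linarith
  have h3 : 1 / C ^ 2 * (1 / (2 * n) * quadForm (regMatrix n k lam) z)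
      ≤ 1 / (2 * n) * quadForm (regMatrix n k lam) g := by
    calc _ ≤ 1 / C ^ 2 * (1 / (2 * n) * (C ^ 2 * quadForm (regMatrix n k lam) g)) := by gcongr
      _ = _ := by field_simp
  have h4 := mul_le_mul_of_nonneg_left
    (show n * (1 - 3 * δ / 2 - S) + quadForm (regMatrix n k lam) g / 2
      ≤ inner ℝ (realify (cleanSignal n f)) g by linarith) (by positivity : 0 ≤ 1 / (n : ℝ))
  have h5 : 1 / (n : ℝ) * (n * (1 - 3 * δ / 2 - S) + quadForm (regMatrix n k lam) g / 2)
      = 1 - 3 * δ / 2 - S + 1 / (2 * n) * quadForm (regMatrix n k lam) g := by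
    field_simp
  linarith

end ModuloDenoise

/-! ### The two cases of the theorem. -/

theorem theorem1 (n k : ℕ) (hn : 2 ≤ n) (hk : 1 ≤ k) (lam : ℝ) (hlam : 0 ≤ lam)
    (M α : ℝ) (hM : 0 < M) (hα : α ∈ Set.Ioc (0 : ℝ) 1)
    (f : ℝ → ℝ)
    (hf : ∀ x ∈ Set.Icc (0 : ℝ) 1, ∀ y ∈ Set.Icc (0 : ℝ) 1, |f x - f y| ≤ M * |x - y| ^ α)
    (η : Fin n → ℝ) (δ : ℝ) (hδ : δ ∈ Set.Icc (0 : ℝ) 1)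
    (h z : EuclideanSpace ℝ (Fin n ⊕ Fin n))
    (hh : h = ModuloDenoise.realify (ModuloDenoise.cleanSignal n f))
    (hz : z = ModuloDenoise.realify (ModuloDenoise.noisySignal n f η))
    (hzh : ‖z - h‖ ≤ δ * √(n : ℝ))
    (H : Matrix (Fin n ⊕ Fin n) (Fin n ⊕ Fin n) ℝ)
    (hH : H = ModuloDenoise.regMatrix n k lam) :
    (z ∉ (ModuloDenoise.nullSpace H)ᗮ →
      ∃ g : EuclideanSpace ℝ (Fin n ⊕ Fin n),
        ModuloDenoise.IsSolution H z g ∧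
        (∀ g', ModuloDenoise.IsSolution H z g' → g' = g) ∧
        1 - 3 * δ / 2
            - lam * Real.pi ^ 2 * M ^ 2 * (2 * (k : ℝ)) ^ (2 * α + 1) / (n : ℝ) ^ (2 * α)
            + 1 / (4 * lam * k + 1) ^ 2 * (1 / (2 * n) * ModuloDenoise.quadForm H z)
          ≤ 1 / (n : ℝ) * inner ℝ h g) ∧
    (z ∈ (ModuloDenoise.nullSpace H)ᗮ → lam < 1 / (4 * (k : ℝ)) →
      ∃ g : EuclideanSpace ℝ (Fin n ⊕ Fin n),
        ModuloDenoise.IsSolution H z g ∧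
        (∀ g', ModuloDenoise.IsSolution H z g' → g' = g) ∧
        1 - 3 * δ / 2
            - lam * Real.pi ^ 2 * M ^ 2 * (2 * (k : ℝ)) ^ (2 * α + 1) / (n : ℝ) ^ (2 * α)
            + 1 / (1 + 4 * lam * k - 4 * lam * k * Real.sin (Real.pi / (2 * n)) ^ 2) ^ 2
                * (1 / (2 * n) * ModuloDenoise.quadForm H z)
          ≤ 1 / (n : ℝ) * inner ℝ h g) := by
  have hn0 : (0 : ℝ) < n := by exact_mod_cast (by omega : 0 < n)
  have hz2 : ‖z‖ ^ 2 = n := by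
    rw [hz]
    exact ModuloDenoise.norm_realify_sq fun i => ModuloDenoise.norm_exp_two_pi_mul_I _
  have hcos := Real.cos_sq' (Real.pi / (2 * n))
  have hlk : 0 ≤ 4 * lam * k := by positivity
  have hc := mul_le_mul_of_nonneg_left (Real.cos_sq_le_one (Real.pi / (2 * n))) hlk
  subst hH hh
  refine ⟨fun hzN => ?_, fun hzN hlt => ?_⟩
  · refine ModuloDenoise.exists_solution_of_forall_ne hn hlam hM.le hα.1.le hf hδ hz2 hzh
      (fun g _ hg => hzN ?_) (by linarith)
    rw [Submodule.mem_orthogonal]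
    intro u hu
    rw [← hg, ← ModuloDenoise.isSymmetric_regMatrix n k lam u g, LinearMap.mem_ker.1 hu,
      inner_zero_left]
  · refine ModuloDenoise.exists_solution_of_forall_ne hn hlam hM.le hα.1.le hf hδ hz2 hzh
      (fun g hgn hg => ?_) (le_of_eq (by rw [hcos]; ring))
    have hlt1 : 4 * lam * k < 1 := by
      have hk0 : (0 : ℝ) < k := by exact_mod_cast hk
      rw [lt_div_iff₀ (by positivity)] at hlt
      linarith
    set c := 4 * lam * k * Real.cos (Real.pi / (2 * n)) ^ 2
    have hc0 : 0 ≤ c := by positivity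
    have hle : ModuloDenoise.quadForm (ModuloDenoise.regMatrix n k lam) g ≤ c * ‖g‖ ^ 2 :=
      ModuloDenoise.quadForm_regMatrix_le (by omega) k hlam g
    have h1 : ‖Matrix.toEuclideanLin (ModuloDenoise.regMatrix n k lam) g‖ ^ 2
        ≤ c * ModuloDenoise.quadForm (ModuloDenoise.regMatrix n k lam) g :=
      (ModuloDenoise.isSymmetric_regMatrix n k lam).norm_sq_apply_le
        (ModuloDenoise.quadForm_regMatrix_nonneg n k hlam)
        (ModuloDenoise.quadForm_regMatrix_le (by omega) k hlam) hc0 g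
    rw [hg, hz2] at h1
    rw [hgn] at hle
    have hc1 : c < 1 := by linarith
    have h2 := mul_le_mul_of_nonneg_left hle hc0
    -- If `H g = z` on the sphere, then `n = ‖H g‖² ≤ c² n`, impossible for `c < 1`.
    have h3 : c * c < 1 := by nlinarith
    nlinarith [mul_lt_mul_of_pos_right h3 hn0]
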